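/- Let $n \ge 0$ and let $\mathcal K_n$ be the set of all convex bodies in $\mathbb R^n$, i.e. compact convex subsets of $\mathbb R^n$ with nonempty interior, equipped with the Hausdorff distance induced by the Euclidean metric. Let $\mathrm{Aff}(n)$ be the group of nonsingular affine maps of $\mathbb R^n$, acting on $\mathcal K_n$ by $gK=\{gx : x\in K\}$. An affine invariant point is a continuous map $p:\mathcal K_n\to\mathbb R^n$ with $p(gA)=g\,p(A)$ for all $g\in \mathrm{Aff}(n)$ and $A\in\mathcal K_n$; it is called proper if $p(A)\in\mathrm{Int}(A)$ for every $A\in\mathcal K_n$. For $K\in\mathcal K_n$ put $$\mathfrak F_n(K)=\{x\in\mathbb R^n : gx=x \text{ for every } g\in \mathrm{Aff}(n) \text{ with } gK=K\}.$$ Theorem. Let $K\in\mathcal K_n$ and $x\in\mathfrak F_n(K)$. If $x\in\mathrm{Int}(K)$, then there is a proper affine invariant point $p$ such that $p(K)=x$. -/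

import Mathlib

/-- The Euclidean space `ℝⁿ`. -/
abbrev EucSpace (n : ℕ) : Type := EuclideanSpace ℝ (Fin n)

/-- The space `𝒦ₙ` of compact convex subsets of `ℝⁿ` with nonempty interior. The metric (hence the
topology) is the one induced from `ConvexBody`, i.e. the Hausdorff distance for the Euclidean
metric. -/
abbrev SolidBody (n : ℕ) : Type :=
  {K : ConvexBody (EucSpace n) // (interior (K : Set (EucSpace n))).Nonempty}

/-- The group `Aff(n)` of nonsingular affine maps of `ℝⁿ`. -/
abbrev Aff (n : ℕ) : Type := EucSpace n ≃ᵃ[ℝ] EucSpace n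

namespace SolidBody

variable {n : ℕ}

/-- The underlying subset of `ℝⁿ`. -/
def toSet (K : SolidBody n) : Set (EucSpace n) := (K.1 : Set (EucSpace n))

theorem interior_image_nonempty (g : Aff n) (K : SolidBody n) :
    (interior (g '' K.toSet)).Nonempty := by
  have h := (AffineEquiv.toContinuousAffineEquiv g).toHomeomorph.image_interior K.toSet
  change g '' interior K.toSet = interior (g '' K.toSet) at h
  rw [← h]
  exact K.2.image _

/-- The action of `Aff(n)` on `𝒦ₙ`, `gK = {g x | x ∈ K}`. -/
def map (g : Aff n) (K : SolidBody n) : SolidBody n :=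
  ⟨{ carrier := g '' K.toSet
     convex' := K.1.convex.affine_image (g : EucSpace n →ᵃ[ℝ] EucSpace n)
     isCompact' := K.1.isCompact.image g.continuous_of_finiteDimensional
     nonempty' := K.1.nonempty.image g },
   interior_image_nonempty g K⟩

/-- The set `𝔉ₙ(K)` of points fixed by every nonsingular affine map `g` with `gK = K`. -/
def fixedPoints (K : SolidBody n) : Set (EucSpace n) :=
  {x | ∀ g : Aff n, map g K = K → g x = x}

end SolidBody

/-- The set `𝔓ₙ` of affine invariant points: continuous `Aff(n)`-equivariant maps
`p : 𝒦ₙ → ℝⁿ`. -/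
def affineInvariantPoints (n : ℕ) : Set (SolidBody n → EucSpace n) :=
  {p | Continuous p ∧ ∀ (g : Aff n) (K : SolidBody n), p (SolidBody.map g K) = g (p K)}

/-- An affine invariant point `p` is proper if `p(A) ∈ Int(A)` for every `A ∈ 𝒦ₙ`. -/
def IsProperAffineInvariantPoint {n : ℕ} (p : SolidBody n → EucSpace n) : Prop :=
  p ∈ affineInvariantPoints n ∧ ∀ A : SolidBody n, p A ∈ interior A.toSet

open Set Filter Topology MeasureTheory

namespace SolidBody

variable {n : ℕ}

/-! Since `x` is fixed by the symmetries of `K`, the rule `hK ↦ h x` is well defined on the affine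
orbit of `K`; it has to be extended continuously and equivariantly to all bodies `A`.

The affine maps `g` with `gK ⊆ A` form a compact convex set `fit K A`. Let `M` be the maximum of
`|det g|` on it and `r = M vol K / vol A ≤ 1`. Both depend continuously on `A`, `r` is affine
invariant, and `r = 1` exactly on the orbit (`fillRatio_eq_one_iff`). Off the orbit, `p(A)` is the
average of `g x` over `fit K A` with weight `max(0, |det g| - rM)`, whose total is then positive. A
change of variables makes the average equivariant (`weightedAverage_map`).

As `A` approaches `hK`, the threshold `rM` tends to the maximum, so only nearly extremal maps count.
Extremal maps for `hK` send `K` onto `hK` and hence `x` to `h x`; compactness gives continuity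
(`continuousAt_extendedPoint_map_self`). Maps with positive weight are nonsingular, so they send `x
∈ Int K` into the convex set `Int A`, and the average stays there (`extendedPoint_mem`). -/

theorem isCompact_toSet (A : SolidBody n) : IsCompact A.toSet := A.1.isCompact

theorem isClosed_toSet (A : SolidBody n) : IsClosed A.toSet := A.1.isCompact.isClosed

theorem convex_toSet (A : SolidBody n) : Convex ℝ A.toSet := A.1.convex

theorem interior_toSet_nonempty (A : SolidBody n) : (interior A.toSet).Nonempty := A.2

theorem toSet_injective : Function.Injective (toSet : SolidBody n → Set (EucSpace n)) :=
  fun _ _ h => Subtype.ext (ConvexBody.ext h)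

theorem toSet_map (g : Aff n) (A : SolidBody n) : (map g A).toSet = g '' A.toSet := rfl

theorem map_map (g h : Aff n) (A : SolidBody n) : map g (map h A) = map (h.trans g) A :=
  toSet_injective <| by
    rw [toSet_map, toSet_map, toSet_map, image_image]
    rfl

theorem map_symm_map (g : Aff n) (A : SolidBody n) : map g.symm (map g A) = A :=
  toSet_injective <| by
    rw [toSet_map, toSet_map, image_image]
    simp

/-- The homothety of centre `c` and ratio `s ≠ 0`, as a nonsingular affine map. -/
noncomputable def dilation (c : EucSpace n) (s : ℝ) (hs : s ≠ 0) : Aff n :=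
  AffineEquiv.homothetyUnitsMulHom c (Units.mk0 s hs)

theorem dilation_apply (c : EucSpace n) (s : ℝ) (hs : s ≠ 0) (y : EucSpace n) :
    dilation c s hs y = s • (y - c) + c := by
  simp [dilation, AffineMap.homothety_apply]

theorem dilation_linear (c : EucSpace n) (s : ℝ) (hs : s ≠ 0) :
    ((dilation c s hs).linear : EucSpace n →ₗ[ℝ] EucSpace n) = s • LinearMap.id := by
  ext1 v
  have h : (dilation c s hs).linear (v -ᵥ 0)
      = dilation c s hs v -ᵥ dilation c s hs 0 :=
    ((dilation c s hs) : EucSpace n →ᵃ[ℝ] EucSpace n).linearMap_vsub v 0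
  simp only [vsub_eq_sub, sub_zero, dilation_apply] at h
  simp only [LinearEquiv.coe_coe, LinearMap.smul_apply, LinearMap.id_apply]
  rw [h, zero_sub, smul_neg, smul_sub]
  abel

/-- The modulus of the determinant of the linear part of a nonsingular affine map. -/
noncomputable def absDet (g : Aff n) : ℝ :=
  |LinearMap.det (g.linear : EucSpace n →ₗ[ℝ] EucSpace n)|

theorem absDet_pos (g : Aff n) : 0 < absDet g :=
  abs_pos.2 (LinearEquiv.isUnit_det' g.linear).ne_zero

theorem absDet_symm (g : Aff n) : absDet g.symm = (absDet g)⁻¹ := by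
  rw [absDet, absDet, ← abs_inv]
  congr 1
  apply eq_inv_of_mul_eq_one_left
  rw [← LinearMap.det_comp]
  convert LinearMap.det_id (M := EucSpace n) (A := ℝ)
  ext1 v
  exact g.linear.symm_apply_apply v

theorem absDet_dilation (c : EucSpace n) {s : ℝ} (hs : 0 < s) :
    absDet (dilation c s hs.ne') = s ^ n := by
  rw [absDet, dilation_linear, LinearMap.det_smul]
  simp [abs_of_pos hs]

/-! ### Hausdorff neighbourhoods and homothetic copies -/

theorem hausdorffEDist_toSet_ne_top (A B : SolidBody n) :
    Metric.hausdorffEDist A.toSet B.toSet ≠ ⊤ :=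
  ConvexBody.hausdorffEDist_ne_top

theorem hausdorffDist_toSet (A B : SolidBody n) :
    Metric.hausdorffDist A.toSet B.toSet = dist A B := rfl

/-- A point `y` of `A` is close to some `a ∈ A₀`; the small error `y - a`, divided by `s - 1`, still
fits in a ball around `c` inside `A₀`, so convexity absorbs it. -/
theorem eventually_subset_dilation (A₀ : SolidBody n) {c : EucSpace n}
    (hc : c ∈ interior A₀.toSet) {s : ℝ} (hs : 1 < s) :
    ∀ᶠ A in 𝓝 A₀, A.toSet ⊆ (map (dilation c s (by positivity)) A₀).toSet := by
  obtain ⟨r, hr, hball⟩ := Metric.isOpen_iff.1 isOpen_interior c hc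
  set t := s - 1 with ht
  have ht0 : 0 < t := by linarith
  filter_upwards [Metric.ball_mem_nhds A₀ (mul_pos ht0 hr)] with A hA y hy
  rw [Metric.mem_ball, ← hausdorffDist_toSet] at hA
  obtain ⟨a, ha, hya⟩ :=
    Metric.exists_dist_lt_of_hausdorffDist_lt hy hA (hausdorffEDist_toSet_ne_top _ _)
  have hu : c + t⁻¹ • (y - a) ∈ A₀.toSet := by
    apply interior_subset (hball _)
    rw [Metric.mem_ball, dist_eq_norm, add_sub_cancel_left, norm_smul, Real.norm_eq_abs,
      abs_of_pos (inv_pos.2 ht0), inv_mul_lt_iff₀ ht0, ← dist_eq_norm]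
    exact hya
  refine ⟨(1 / s) • a + (t / s) • (c + t⁻¹ • (y - a)),
    A₀.convex_toSet ha hu (by positivity) (by positivity) ?_, ?_⟩
  · rw [← add_div, ht]; field_simp; ring
  · have hs0 : s ≠ 0 := by positivity
    rw [dilation_apply, smul_sub, smul_add, smul_smul, smul_smul, mul_one_div_cancel hs0,
      mul_div_cancel₀ _ hs0, smul_add, smul_smul, mul_inv_cancel₀ ht0.ne', ht, sub_smul]
    simp only [one_smul]
    abel

/-- If `z` in the shrunken copy misses `A`, let `u` be the unit vector from its nearest point in `A`
towards `z`. Moving `z` by `t * (r / 2)` along `u` stays in `A₀` but ends farther than that from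
`A`. -/
theorem eventually_dilation_subset (A₀ : SolidBody n) {c : EucSpace n}
    (hc : c ∈ interior A₀.toSet) {s : ℝ} (hs0 : 0 < s) (hs : s < 1) :
    ∀ᶠ A in 𝓝 A₀, (map (dilation c s hs0.ne') A₀).toSet ⊆ A.toSet := by
  obtain ⟨r, hr, hball⟩ := Metric.isOpen_iff.1 isOpen_interior c hc
  set t := 1 - s with ht
  have ht0 : 0 < t := by linarith
  have hδ : 0 < t * (r / 2) := by positivity
  filter_upwards [Metric.ball_mem_nhds A₀ hδ] with A hA
  rintro _ ⟨y, hy, rfl⟩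
  rw [Metric.mem_ball, ← hausdorffDist_toSet] at hA
  rw [dilation_apply]
  by_contra hz
  set z := s • (y - c) + c with hzdef
  obtain ⟨q, hq, hmin⟩ := exists_norm_eq_iInf_of_complete_convex (K := A.toSet)
    A.1.nonempty A.isCompact_toSet.isComplete A.convex_toSet z
  rw [norm_eq_iInf_iff_real_inner_le_zero A.convex_toSet hq] at hmin
  have hne : z - q ≠ 0 := fun h => hz (by rwa [sub_eq_zero.1 h])
  have hpos : 0 < ‖z - q‖ := norm_pos_iff.2 hne
  set u := ‖z - q‖⁻¹ • (z - q) with hu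
  have hu1 : ‖u‖ = 1 := by
    rw [hu, norm_smul, norm_inv, norm_norm, inv_mul_cancel₀ hpos.ne']
  have hz' : z + (t * (r / 2)) • u ∈ A₀.toSet := by
    have hcu : c + (r / 2) • u ∈ A₀.toSet := by
      apply interior_subset (hball _)
      rw [Metric.mem_ball, dist_eq_norm, add_sub_cancel_left, norm_smul, hu1, Real.norm_eq_abs,
        abs_of_pos (by positivity)]
      linarith
    convert A₀.convex_toSet hy hcu hs0.le ht0.le (by rw [ht]; ring) using 1
    rw [hzdef, ht]
    clear_value u
    module
  obtain ⟨a, ha, hd⟩ :=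
    Metric.exists_dist_lt_of_hausdorffDist_lt' hz' hA (hausdorffEDist_toSet_ne_top _ _)
  rw [dist_comm, dist_eq_norm] at hd
  have h1 : inner ℝ u (a - q) ≤ 0 := by
    rw [hu, real_inner_smul_left]
    exact mul_nonpos_of_nonneg_of_nonpos (by positivity) (hmin a ha)
  have h2 : inner ℝ u (z - q) = ‖z - q‖ := by
    rw [hu, real_inner_smul_left, real_inner_self_eq_norm_sq, sq, ← mul_assoc,
      inv_mul_cancel₀ hpos.ne', one_mul]
  have h3 : inner ℝ u (z + (t * (r / 2)) • u - a) ≤ ‖z + (t * (r / 2)) • u - a‖ := by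
    have := real_inner_le_norm u (z + (t * (r / 2)) • u - a)
    rwa [hu1, one_mul] at this
  have h4 : z + (t * (r / 2)) • u - a = (z - q) + (t * (r / 2)) • u - (a - q) := by abel
  rw [h4, inner_sub_right, inner_add_right, h2, real_inner_smul_right,
    real_inner_self_eq_norm_sq, hu1, ← h4] at h3
  linarith

/-- A functional on convex bodies that is monotone and scales with the determinant is
continuous. -/
theorem continuous_of_monotone_of_homogeneous {φ : SolidBody n → ℝ}
    (hmono : ∀ A B : SolidBody n, A.toSet ⊆ B.toSet → φ A ≤ φ B)
    (hhom : ∀ (g : Aff n) (A : SolidBody n), φ (map g A) = absDet g * φ A) :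
    Continuous φ := by
  refine continuous_iff_continuousAt.2 fun A₀ => ?_
  obtain ⟨c, hc⟩ := A₀.interior_toSet_nonempty
  -- Bodies near `A₀` lie between homothetic copies of ratios `s < 1` and `s > 1`, on which `φ`
  -- equals `s ^ n * φ A₀`.
  have hlim : Tendsto (fun s : ℝ => s ^ n * φ A₀) (𝓝 1) (𝓝 (φ A₀)) := by
    have : ContinuousAt (fun s : ℝ => s ^ n * φ A₀) 1 := by fun_prop
    simpa [ContinuousAt] using this
  refine tendsto_order.2 ⟨fun a ha => ?_, fun a ha => ?_⟩
  · have h1 := (hlim.mono_left (nhdsWithin_le_nhds (s := Iio 1))).eventually (lt_mem_nhds ha)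
    have h2 : ∀ᶠ s : ℝ in 𝓝[<] 1, s ∈ Ioo (0 : ℝ) 1 := Ioo_mem_nhdsLT zero_lt_one
    obtain ⟨s, hs, hs0, hs1⟩ := (h1.and h2).exists
    filter_upwards [eventually_dilation_subset A₀ hc hs0 hs1] with A hA
    have := hmono _ _ hA
    rw [hhom, absDet_dilation c hs0] at this
    exact hs.trans_le this
  · have h1 := (hlim.mono_left (nhdsWithin_le_nhds (s := Ioi 1))).eventually (gt_mem_nhds ha)
    have h2 : ∀ᶠ s : ℝ in 𝓝[>] 1, s ∈ Ioi (1 : ℝ) := self_mem_nhdsWithin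
    obtain ⟨s, hs, hs1⟩ := (h1.and h2).exists
    filter_upwards [eventually_subset_dilation A₀ hc hs1] with A hA
    have := hmono _ _ hA
    rw [hhom, absDet_dilation c (by linarith [mem_Ioi.1 hs1])] at this
    exact this.trans_lt hs

/-! ### Volume -/

/-- The volume of a convex body, as a real number. -/
noncomputable def vol (A : SolidBody n) : ℝ := (volume A.toSet).toReal

theorem volume_toSet_ne_top (A : SolidBody n) : volume A.toSet ≠ ⊤ :=
  A.isCompact_toSet.measure_ne_top

theorem vol_pos (A : SolidBody n) : 0 < vol A :=
  ENNReal.toReal_pos (Measure.measure_pos_of_nonempty_interior _ A.interior_toSet_nonempty).ne'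
    A.volume_toSet_ne_top

theorem vol_mono (A B : SolidBody n) (h : A.toSet ⊆ B.toSet) : vol A ≤ vol B :=
  ENNReal.toReal_mono B.volume_toSet_ne_top (measure_mono h)

theorem Aff_apply (g : Aff n) (y : EucSpace n) : g y = g.linear y + g 0 := by
  have := g.map_vadd 0 y
  simpa using this

theorem vol_map (g : Aff n) (A : SolidBody n) : vol (map g A) = absDet g * vol A := by
  have h : g '' A.toSet = (fun y => y + g 0) ''
      ((g.linear : EucSpace n →ₗ[ℝ] EucSpace n) '' A.toSet) := by
    rw [image_image]
    exact image_congr fun y _ => Aff_apply g y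
  rw [vol, toSet_map, h, image_add_right, measure_preimage_add_right,
    Measure.addHaar_image_linearMap, ENNReal.toReal_mul, ENNReal.toReal_ofReal (abs_nonneg _)]
  rfl

theorem continuous_vol : Continuous (vol : SolidBody n → ℝ) :=
  continuous_of_monotone_of_homogeneous vol_mono vol_map

/-- Convex bodies that are nested and have the same volume coincide. -/
theorem eq_of_subset_of_vol_le {A B : SolidBody n} (h : A.toSet ⊆ B.toSet)
    (hvol : vol B ≤ vol A) : A = B := by
  apply toSet_injective
  refine h.antisymm fun b hb => ?_
  by_contra hbA
  -- A point of `B` outside `A` is a limit of interior points of `B`, so `B \ A` contains a nonempty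
  -- open set.
  have hb' : b ∈ closure (interior B.toSet) := by
    rw [B.convex_toSet.closure_interior_eq_closure_of_nonempty_interior B.interior_toSet_nonempty]
    exact subset_closure hb
  have hne : (A.toSetᶜ ∩ interior B.toSet).Nonempty :=
    mem_closure_iff.1 hb' _ A.isClosed_toSet.isOpen_compl hbA
  have hpos : 0 < volume (A.toSetᶜ ∩ interior B.toSet) :=
    (A.isClosed_toSet.isOpen_compl.inter isOpen_interior).measure_pos _ hne
  have hle : volume A.toSet + volume (A.toSetᶜ ∩ interior B.toSet) ≤ volume B.toSet := by
    rw [← measure_union (disjoint_compl_right.mono_right inter_subset_left)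
      (A.isClosed_toSet.isOpen_compl.inter isOpen_interior).measurableSet]
    exact measure_mono (union_subset h (inter_subset_right.trans interior_subset))
  have hBA : volume B.toSet ≤ volume A.toSet :=
    (ENNReal.toReal_le_toReal B.volume_toSet_ne_top A.volume_toSet_ne_top).1 hvol
  exact absurd (hle.trans hBA) (not_le.2 (ENNReal.lt_add_right A.volume_toSet_ne_top hpos.ne'))

end SolidBody

/-- Stated for normed spaces, since instance search is slow for the general version on spaces
of operators. -/
theorem Convex.closure_interior_eq_of_normedSpace {V : Type*} [NormedAddCommGroup V]
    [NormedSpace ℝ V] {s : Set V} (hs : Convex ℝ s) (hne : (interior s).Nonempty) :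
    closure (interior s) = closure s :=
  hs.closure_interior_eq_closure_of_nonempty_interior hne

/-- Affine self-maps `y ↦ L y + b` of `ℝⁿ`, singular ones included, as pairs `(L, b)`. -/
abbrev AffinePair (n : ℕ) : Type := (EucSpace n →L[ℝ] EucSpace n) × EucSpace n

/-! ### The vector space of affine self-maps -/

namespace AffinePair

variable {n : ℕ}

/-- The value of an affine map at a point. -/
def eval (g : AffinePair n) (y : EucSpace n) : EucSpace n := g.1 y + g.2

/-- The modulus of the determinant of the linear part. -/
noncomputable def detAbs (g : AffinePair n) : ℝ := |g.1.det|

theorem detAbs_nonneg (g : AffinePair n) : 0 ≤ detAbs g := abs_nonneg _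

theorem continuous_detAbs : Continuous (detAbs : AffinePair n → ℝ) :=
  (ContinuousLinearMap.continuous_det.comp continuous_fst).abs

theorem continuous_eval_left (y : EucSpace n) : Continuous fun g : AffinePair n => eval g y := by
  unfold eval
  fun_prop

/-- A nonsingular affine map as a pair. -/
noncomputable def ofAff (h : Aff n) : AffinePair n :=
  (LinearMap.toContinuousLinearMap (h.linear : EucSpace n →ₗ[ℝ] EucSpace n), h 0)

theorem eval_ofAff (h : Aff n) (y : EucSpace n) : eval (ofAff h) y = h y :=
  (SolidBody.Aff_apply h y).symm

theorem detAbs_ofAff (h : Aff n) : detAbs (ofAff h) = SolidBody.absDet h := rfl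

theorem exists_ofAff_eq {g : AffinePair n} (hg : detAbs g ≠ 0) : ∃ h : Aff n, ofAff h = g := by
  have hdet : LinearMap.det (g.1 : EucSpace n →ₗ[ℝ] EucSpace n) ≠ 0 := abs_ne_zero.1 hg
  let L := LinearMap.equivOfDetNeZero _ hdet
  have hL : ∀ y, L y = g.1 y := fun y => rfl
  refine ⟨L.toAffineEquiv.trans (AffineEquiv.constVAdd ℝ (EucSpace n) g.2), ?_⟩
  refine Prod.ext ?_ ?_
  · ext1 y
    exact hL y
  · simp [ofAff]

/-- Composition with a nonsingular affine map on the left. -/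
noncomputable def postcomp (h : Aff n) (g : AffinePair n) : AffinePair n :=
  ((ofAff h).1.comp g.1, h g.2)

theorem eval_postcomp (h : Aff n) (g : AffinePair n) (y : EucSpace n) :
    eval (postcomp h g) y = h (eval g y) := by
  rw [SolidBody.Aff_apply h (eval g y), eval, eval, map_add, add_assoc,
    ← SolidBody.Aff_apply h g.2]
  rfl

theorem ext_eval {g g' : AffinePair n} (h : ∀ y, eval g y = eval g' y) : g = g' := by
  have h0 : g.2 = g'.2 := by simpa [eval] using h 0
  refine Prod.ext ?_ h0
  ext1 y
  have := h y
  rw [eval, eval, h0] at this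
  exact add_right_cancel this

theorem postcomp_symm_postcomp (h : Aff n) (g : AffinePair n) :
    postcomp h.symm (postcomp h g) = g :=
  ext_eval fun y => by simp [eval_postcomp]

theorem postcomp_postcomp_symm (h : Aff n) (g : AffinePair n) :
    postcomp h (postcomp h.symm g) = g :=
  ext_eval fun y => by simp [eval_postcomp]

theorem postcomp_injective (h : Aff n) : Function.Injective (postcomp h) :=
  Function.LeftInverse.injective (postcomp_symm_postcomp h)

theorem detAbs_postcomp (h : Aff n) (g : AffinePair n) :
    detAbs (postcomp h g) = SolidBody.absDet h * detAbs g := by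
  rw [detAbs, detAbs, SolidBody.absDet, ← abs_mul]
  congr 1
  exact LinearMap.det_comp _ _

/-- The linear part of `postcomp h`. -/
noncomputable def postcompLinear (h : Aff n) : AffinePair n →L[ℝ] AffinePair n :=
  ((ContinuousLinearMap.compL ℝ (EucSpace n) (EucSpace n) (EucSpace n) (ofAff h).1).comp
    (ContinuousLinearMap.fst ℝ _ _)).prod ((ofAff h).1.comp (ContinuousLinearMap.snd ℝ _ _))

theorem postcomp_eq (h : Aff n) (g : AffinePair n) :
    postcomp h g = postcompLinear h g + (0, h 0) := by
  refine Prod.ext ?_ ?_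
  · simp [postcomp, postcompLinear]
  · exact SolidBody.Aff_apply h g.2

theorem hasFDerivAt_postcomp (h : Aff n) (g : AffinePair n) :
    HasFDerivAt (postcomp h) (postcompLinear h) g := by
  have := (postcompLinear h).hasFDerivAt (x := g) |>.add_const ((0, h 0) : AffinePair n)
  exact this.congr_of_eventuallyEq (Eventually.of_forall fun g => postcomp_eq h g)

end AffinePair

/-! ### The compact convex set of affine maps from `K` into `A` -/

namespace SolidBody

open AffinePair

variable {n : ℕ}

/-- The affine maps, singular ones included, that send `K` into `A`. -/
def fit (K A : SolidBody n) : Set (AffinePair n) := {g | ∀ y ∈ K.toSet, eval g y ∈ A.toSet}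

theorem fit_mono (K : SolidBody n) {A B : SolidBody n} (h : A.toSet ⊆ B.toSet) :
    fit K A ⊆ fit K B := fun _ hg y hy => h (hg y hy)

theorem ofAff_mem_fit (K A : SolidBody n) (h : Aff n) :
    ofAff h ∈ fit K A ↔ (map h K).toSet ⊆ A.toSet := by
  rw [toSet_map, image_subset_iff]
  exact forall₂_congr fun y _ => by rw [eval_ofAff]; rfl

theorem postcomp_mem_fit_map (K A : SolidBody n) (h : Aff n) (g : AffinePair n) :
    postcomp h g ∈ fit K (map h A) ↔ g ∈ fit K A :=
  forall₂_congr fun y _ => by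
    rw [eval_postcomp, toSet_map, h.injective.mem_set_image]

theorem fit_map (K A : SolidBody n) (h : Aff n) :
    fit K (map h A) = postcomp h '' fit K A := by
  ext g
  constructor
  · intro hg
    rw [← postcomp_postcomp_symm h g, postcomp_mem_fit_map] at hg
    exact ⟨_, hg, postcomp_postcomp_symm h g⟩
  · rintro ⟨g, hg, rfl⟩
    exact (postcomp_mem_fit_map K A h g).2 hg

theorem convex_fit (K A : SolidBody n) : Convex ℝ (fit K A) := by
  intro g hg g' hg' a b ha hb hab y hy
  convert A.convex_toSet (hg y hy) (hg' y hy) ha hb hab using 1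
  simp only [eval, Prod.fst_add, Prod.smul_fst, Prod.snd_add, Prod.smul_snd,
    add_apply, smul_apply, smul_add]
  abel

theorem isClosed_fit (K A : SolidBody n) : IsClosed (fit K A) := by
  have : fit K A = ⋂ y ∈ K.toSet, (fun g => eval g y) ⁻¹' A.toSet := by
    ext g
    simp [fit]
  rw [this]
  exact isClosed_biInter fun y _ => A.isClosed_toSet.preimage (continuous_eval_left y)

theorem isCompact_fit (K A : SolidBody n) : IsCompact (fit K A) := by
  obtain ⟨k, hk⟩ := K.interior_toSet_nonempty
  obtain ⟨r, hr, hball⟩ := Metric.isOpen_iff.1 isOpen_interior k hk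
  obtain ⟨R, hR⟩ := A.isCompact_toSet.isBounded.exists_norm_le
  have hR0 : 0 ≤ R := by
    obtain ⟨a, ha⟩ := A.interior_toSet_nonempty
    exact (norm_nonneg a).trans (hR a (interior_subset ha))
  refine Metric.isCompact_of_isClosed_isBounded (isClosed_fit K A) ?_
  -- For `r / 2 ≤ ‖v‖ < r`, `g.1 v` is a difference of two points of `A`, so its norm is at most `2
  -- * R = C * (r / 2)`.
  set C := 4 * R / r with hC
  have hC0 : 0 ≤ C := by positivity
  refine isBounded_iff_forall_norm_le.2 ⟨max C (R + C * ‖k‖), fun g hg => ?_⟩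
  have hk' := hR _ (hg k (interior_subset hk))
  have h1 : ‖g.1‖ ≤ C := by
    refine ContinuousLinearMap.opNorm_le_of_shell (c := (2 : ℝ)) hr hC0 (by norm_num) ?_
    intro v hv hvr
    have hv' := hR _ (hg (k + v) (interior_subset (hball (by simpa using hvr))))
    have h2 : g.1 v = eval g (k + v) - eval g k := by
      simp only [eval, map_add]
      abel
    rw [h2]
    refine (norm_sub_le _ _).trans ((add_le_add hv' hk').trans ?_)
    have h3 : r / 2 ≤ ‖v‖ := by simpa using hv
    calc R + R = C * (r / 2) := by rw [hC]; field_simp; ring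
      _ ≤ C * ‖v‖ := by gcongr
  have h2 : ‖g.2‖ ≤ R + C * ‖k‖ := by
    have : g.2 = eval g k - g.1 k := by simp [eval]
    rw [this]
    refine (norm_sub_le _ _).trans (add_le_add hk' ((g.1.le_opNorm k).trans ?_))
    gcongr
  exact max_le_max h1 h2

/-- As `K` is bounded, small perturbations of the constant map `c` still send `K` into a ball around
`c` inside `A`. -/
theorem mem_interior_fit {K A : SolidBody n} {c : EucSpace n} (hc : c ∈ interior A.toSet) :
    ((0, c) : AffinePair n) ∈ interior (fit K A) := by
  obtain ⟨r, hr, hball⟩ := Metric.isOpen_iff.1 isOpen_interior c hc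
  obtain ⟨R, hR⟩ := K.isCompact_toSet.isBounded.exists_norm_le
  have hcont : Continuous fun g : AffinePair n => ‖g.1‖ * R + ‖g.2 - c‖ := by fun_prop
  refine mem_interior.2 ⟨{g | ‖g.1‖ * R + ‖g.2 - c‖ < r}, ?_,
    isOpen_lt hcont continuous_const, by simpa using hr⟩
  intro g hg y hy
  apply interior_subset (hball _)
  rw [mem_ofPred_eq] at hg
  rw [Metric.mem_ball, dist_eq_norm, eval, add_sub_assoc]
  refine ((norm_add_le _ _).trans (add_le_add_left ?_ _)).trans_lt hg
  exact (g.1.le_opNorm y).trans (by gcongr; exact hR y hy)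

theorem interior_fit_nonempty (K A : SolidBody n) : (interior (fit K A)).Nonempty := by
  obtain ⟨c, hc⟩ := A.interior_toSet_nonempty
  exact ⟨_, mem_interior_fit hc⟩

theorem closure_interior_fit (K A : SolidBody n) : closure (interior (fit K A)) = fit K A := by
  have h := (convex_fit K A).closure_interior_eq_of_normedSpace (interior_fit_nonempty K A)
  exact h.trans (isClosed_fit K A).closure_eq

/-! ### Extremal determinant and filling ratio -/

/-- The largest modulus of the determinant of an affine map sending `K` into `A`. -/
noncomputable def maxDet (K A : SolidBody n) : ℝ := sSup (detAbs '' fit K A)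

theorem isGreatest_maxDet (K A : SolidBody n) :
    IsGreatest (detAbs '' fit K A) (maxDet K A) :=
  ((isCompact_fit K A).image continuous_detAbs).isGreatest_sSup
    (((interior_fit_nonempty K A).mono interior_subset).image _)

theorem exists_mem_fit_detAbs_eq (K A : SolidBody n) :
    ∃ g ∈ fit K A, detAbs g = maxDet K A := (isGreatest_maxDet K A).1

theorem detAbs_le_maxDet {K A : SolidBody n} {g : AffinePair n} (hg : g ∈ fit K A) :
    detAbs g ≤ maxDet K A := (isGreatest_maxDet K A).2 ⟨g, hg, rfl⟩

theorem maxDet_pos (K A : SolidBody n) : 0 < maxDet K A := by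
  obtain ⟨c, hc⟩ := A.interior_toSet_nonempty
  -- Perturbing the constant map `c` by `s • id` with small `s > 0` gives determinant `s ^ n`.
  have hcont : Continuous fun s : ℝ =>
      ((s • ContinuousLinearMap.id ℝ (EucSpace n), c) : AffinePair n) := by fun_prop
  have h1 : ∀ᶠ s : ℝ in 𝓝[>] 0,
      ((s • ContinuousLinearMap.id ℝ (EucSpace n), c) : AffinePair n) ∈ interior (fit K A) := by
    refine nhdsWithin_le_nhds (hcont.continuousAt.eventually_mem ?_)
    have h0 : (0 : ℝ) • ContinuousLinearMap.id ℝ (EucSpace n) = 0 := by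
      ext1 v
      exact zero_smul ℝ v
    exact h0 ▸ isOpen_interior.mem_nhds (mem_interior_fit hc)
  obtain ⟨s, hs, hs0⟩ := (h1.and self_mem_nhdsWithin).exists
  refine lt_of_lt_of_le ?_ (detAbs_le_maxDet (interior_subset hs))
  have : (s • ContinuousLinearMap.id ℝ (EucSpace n)).det = s ^ n := by
    rw [ContinuousLinearMap.det, ContinuousLinearMap.toLinearMap_smul, LinearMap.det_smul]
    simp
  rw [detAbs, this]
  exact abs_pos.2 (pow_ne_zero _ (ne_of_gt hs0))

theorem maxDet_mono (K A B : SolidBody n) (h : A.toSet ⊆ B.toSet) :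
    maxDet K A ≤ maxDet K B := by
  obtain ⟨g, hg, hdet⟩ := exists_mem_fit_detAbs_eq K A
  exact hdet ▸ detAbs_le_maxDet (fit_mono K h hg)

theorem maxDet_map (K : SolidBody n) (h : Aff n) (A : SolidBody n) :
    maxDet K (map h A) = absDet h * maxDet K A := by
  have hle : ∀ (h : Aff n) (A : SolidBody n), absDet h * maxDet K A ≤ maxDet K (map h A) := by
    intro h A
    obtain ⟨g, hg, hdet⟩ := exists_mem_fit_detAbs_eq K A
    rw [← hdet, ← detAbs_postcomp]
    exact detAbs_le_maxDet ((postcomp_mem_fit_map K A h g).2 hg)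
  refine le_antisymm ?_ (hle h A)
  have := hle h.symm (map h A)
  rwa [map_symm_map, absDet_symm, inv_mul_le_iff₀ (absDet_pos h)] at this

theorem continuous_maxDet (K : SolidBody n) : Continuous (maxDet K) :=
  continuous_of_monotone_of_homogeneous (maxDet_mono K) (maxDet_map K)

/-- The largest proportion of the volume of `A` that an affine image of `K` inside `A` fills. -/
noncomputable def fillRatio (K A : SolidBody n) : ℝ := maxDet K A * vol K / vol A

theorem fillRatio_pos (K A : SolidBody n) : 0 < fillRatio K A :=
  div_pos (mul_pos (maxDet_pos K A) (vol_pos K)) (vol_pos A)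

theorem fillRatio_map (K : SolidBody n) (h : Aff n) (A : SolidBody n) :
    fillRatio K (map h A) = fillRatio K A := by
  rw [fillRatio, fillRatio, maxDet_map, vol_map, mul_assoc,
    mul_div_mul_left _ _ (absDet_pos h).ne']

theorem continuous_fillRatio (K : SolidBody n) : Continuous (fillRatio K) :=
  ((continuous_maxDet K).mul continuous_const).div continuous_vol fun A => (vol_pos A).ne'

theorem fillRatio_le_one (K A : SolidBody n) : fillRatio K A ≤ 1 := by
  obtain ⟨g, hg, hdet⟩ := exists_mem_fit_detAbs_eq K A
  obtain ⟨h, rfl⟩ := exists_ofAff_eq (hdet ▸ (maxDet_pos K A).ne')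
  rw [fillRatio, div_le_one (vol_pos A), ← hdet, detAbs_ofAff, ← vol_map]
  exact vol_mono _ _ ((ofAff_mem_fit K A h).1 hg)

/-- If some affine image of `K` fills `A`, then every extremal affine map sends `K` onto `A`. -/
theorem exists_map_eq_of_fillRatio_eq_one {K A : SolidBody n} (hA : fillRatio K A = 1)
    {g : AffinePair n} (hg : g ∈ fit K A) (hdet : maxDet K A ≤ detAbs g) :
    ∃ h : Aff n, ofAff h = g ∧ map h K = A := by
  obtain ⟨h, rfl⟩ := exists_ofAff_eq ((maxDet_pos K A).trans_le hdet).ne'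
  refine ⟨h, rfl, eq_of_subset_of_vol_le ((ofAff_mem_fit K A h).1 hg) ?_⟩
  rw [fillRatio, div_eq_one_iff_eq (vol_pos A).ne'] at hA
  rw [vol_map, ← hA]
  exact mul_le_mul_of_nonneg_right hdet (vol_pos K).le

theorem fillRatio_map_self (K : SolidBody n) (h : Aff n) : fillRatio K (map h K) = 1 := by
  refine le_antisymm (fillRatio_le_one _ _) ?_
  rw [fillRatio, le_div_iff₀ (vol_pos _), one_mul, vol_map, ← detAbs_ofAff]
  exact mul_le_mul_of_nonneg_right
    (detAbs_le_maxDet ((ofAff_mem_fit K (map h K) h).2 Subset.rfl)) (vol_pos K).le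

theorem fillRatio_eq_one_iff (K A : SolidBody n) :
    fillRatio K A = 1 ↔ ∃ h : Aff n, map h K = A := by
  constructor
  · intro hA
    obtain ⟨g, hg, hdet⟩ := exists_mem_fit_detAbs_eq K A
    obtain ⟨h, -, hh⟩ := exists_map_eq_of_fillRatio_eq_one hA hg hdet.ge
    exact ⟨h, hh⟩
  · rintro ⟨h, rfl⟩
    exact fillRatio_map_self K h

/-! ### Dependence of `fit K A` on `A` -/

theorem dilation_symm (c : EucSpace n) (s : ℝ) (hs : s ≠ 0) :
    (dilation c s hs).symm = dilation c s⁻¹ (inv_ne_zero hs) := by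
  ext1 y
  rw [AffineEquiv.symm_apply_eq, dilation_apply, dilation_apply, add_sub_cancel_right,
    smul_inv_smul₀ hs, sub_add_cancel]

theorem mem_map_iff (h : Aff n) (A : SolidBody n) (y : EucSpace n) :
    y ∈ (map h A).toSet ↔ h.symm y ∈ A.toSet := by
  rw [← h.injective.mem_set_image (a := h.symm y), AffineEquiv.apply_symm_apply]
  rfl

theorem mem_fit_map_iff (K A : SolidBody n) (h : Aff n) (g : AffinePair n) :
    g ∈ fit K (map h A) ↔ postcomp h.symm g ∈ fit K A := by
  rw [← postcomp_mem_fit_map K A h, postcomp_postcomp_symm]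

theorem postcomp_dilation (c : EucSpace n) (s : ℝ) (hs : s ≠ 0) (g : AffinePair n) :
    postcomp (dilation c s hs) g = (s • g.1, s • (g.2 - c) + c) :=
  ext_eval fun y => by
    rw [eval_postcomp, dilation_apply, eval, eval, smul_apply, add_sub_assoc, smul_add, add_assoc]

theorem eventually_notMem {A₀ : SolidBody n} {y : EucSpace n} (hy : y ∉ A₀.toSet) :
    ∀ᶠ p : SolidBody n × EucSpace n in 𝓝 (A₀, y), p.2 ∉ p.1.toSet := by
  obtain ⟨c, hc⟩ := A₀.interior_toSet_nonempty
  have hcont : ContinuousAt (fun s : ℝ => s⁻¹ • (y - c) + c) 1 :=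
    ((continuousAt_inv₀ one_ne_zero).smul continuousAt_const).add continuousAt_const
  have h1 : ∀ᶠ s : ℝ in 𝓝[>] 1, s⁻¹ • (y - c) + c ∈ A₀.toSetᶜ := by
    refine nhdsWithin_le_nhds (hcont.eventually_mem ?_)
    simpa using A₀.isClosed_toSet.isOpen_compl.mem_nhds hy
  obtain ⟨s, hs, hs1⟩ := (h1.and self_mem_nhdsWithin).exists
  have hs1' : 1 < s := hs1
  have hs0 : s ≠ 0 := by positivity
  have hy' : y ∈ (map (dilation c s hs0) A₀).toSetᶜ := by
    rw [mem_compl_iff, mem_map_iff, dilation_symm, dilation_apply]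
    exact hs
  rw [nhds_prod_eq]
  filter_upwards [(eventually_subset_dilation A₀ hc hs1').prod_mk
    ((map (dilation c s hs0) A₀).isClosed_toSet.isOpen_compl.mem_nhds hy')] with p hp hmem
  exact hp.2 (hp.1 hmem)

/-- A single `y ∈ K` sent outside `A₀` witnesses this for all nearby pairs; openness in both
variables is what the later compactness argument needs. -/
theorem eventually_notMem_fit {K A₀ : SolidBody n} {g : AffinePair n} (hg : g ∉ fit K A₀) :
    ∀ᶠ p : SolidBody n × AffinePair n in 𝓝 (A₀, g), p.2 ∉ fit K p.1 := by
  obtain ⟨y, hy, hgy⟩ : ∃ y ∈ K.toSet, eval g y ∉ A₀.toSet := by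
    simpa [fit] using hg
  have hcont : Continuous fun p : SolidBody n × AffinePair n => (p.1, eval p.2 y) :=
    continuous_fst.prodMk ((continuous_eval_left y).comp continuous_snd)
  filter_upwards [hcont.continuousAt.eventually (eventually_notMem hgy)] with p hp hmem
  exact hp (hmem y hy)

/-- An interior `g` still sends `K` into a slightly shrunken copy of `A₀`, which every nearby `A`
contains. -/
theorem eventually_mem_fit {K A₀ : SolidBody n} {g : AffinePair n}
    (hg : g ∈ interior (fit K A₀)) : ∀ᶠ A in 𝓝 A₀, g ∈ fit K A := by
  obtain ⟨c, hc⟩ := A₀.interior_toSet_nonempty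
  have hcont : ContinuousAt (fun s : ℝ => ((s⁻¹ • g.1, s⁻¹ • (g.2 - c) + c) : AffinePair n)) 1 :=
    ((continuousAt_inv₀ one_ne_zero).smul continuousAt_const).prodMk
      (((continuousAt_inv₀ one_ne_zero).smul continuousAt_const).add continuousAt_const)
  have h1 : ∀ᶠ s : ℝ in 𝓝[<] 1,
      ((s⁻¹ • g.1, s⁻¹ • (g.2 - c) + c) : AffinePair n) ∈ interior (fit K A₀) := by
    refine nhdsWithin_le_nhds (hcont.eventually_mem ?_)
    simpa using isOpen_interior.mem_nhds hg
  have h2 : ∀ᶠ s : ℝ in 𝓝[<] 1, s ∈ Ioo (0 : ℝ) 1 := Ioo_mem_nhdsLT zero_lt_one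
  obtain ⟨s, hs, hs0, hs1⟩ := (h1.and h2).exists
  filter_upwards [eventually_dilation_subset A₀ hc hs0 hs1] with A hA
  refine fit_mono K hA ?_
  rw [mem_fit_map_iff, dilation_symm, postcomp_dilation]
  exact interior_subset hs

/-- The weight of an affine map `g` with `gK ⊆ A`: it is positive when the volume of `gK` is
large compared to the maximum possible. -/
noncomputable def weight (K A : SolidBody n) (g : AffinePair n) : ℝ :=
  max 0 (detAbs g - fillRatio K A * maxDet K A)

theorem weight_nonneg (K A : SolidBody n) (g : AffinePair n) : 0 ≤ weight K A g :=
  le_max_left _ _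

theorem fillRatio_mul_maxDet_pos (K A : SolidBody n) : 0 < fillRatio K A * maxDet K A :=
  mul_pos (fillRatio_pos K A) (maxDet_pos K A)

theorem weight_le_detAbs (K A : SolidBody n) (g : AffinePair n) : weight K A g ≤ detAbs g :=
  max_le (detAbs_nonneg g) (sub_le_self _ (fillRatio_mul_maxDet_pos K A).le)

theorem weight_pos_iff (K A : SolidBody n) (g : AffinePair n) :
    0 < weight K A g ↔ fillRatio K A * maxDet K A < detAbs g := by
  simp [weight]

theorem continuous_weight_left (K : SolidBody n) (g : AffinePair n) :
    Continuous fun A => weight K A g :=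
  continuous_const.max
    (continuous_const.sub ((continuous_fillRatio K).mul (continuous_maxDet K)))

theorem continuous_weight_right (K A : SolidBody n) : Continuous (weight K A) :=
  continuous_const.max (continuous_detAbs.sub continuous_const)

theorem weight_map_postcomp (K A : SolidBody n) (h : Aff n) (g : AffinePair n) :
    weight K (map h A) (postcomp h g) = absDet h * weight K A g := by
  rw [weight, weight, fillRatio_map, maxDet_map, detAbs_postcomp,
    mul_max_of_nonneg _ _ (absDet_pos h).le, mul_zero, mul_sub, mul_left_comm]

/-! ### Weighted integrals over affine maps -/

section Integral

variable {F : Type*} [NormedAddCommGroup F] [NormedSpace ℝ F]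

/-- The integral of `φ` over all affine maps sending `K` into `A`, with respect to `weight`. -/
noncomputable def weightedIntegral (K : SolidBody n) (φ : AffinePair n → F) (A : SolidBody n) :
    F :=
  ∫ g in fit K A, weight K A g • φ g ∂(Measure.addHaar : Measure (AffinePair n))

theorem integrableOn_weight_smul (K A : SolidBody n) {φ : AffinePair n → F}
    (hφ : Continuous φ) :
    IntegrableOn (fun g => weight K A g • φ g) (fit K A)
      (Measure.addHaar : Measure (AffinePair n)) :=
  ((continuous_weight_right K A).smul hφ).continuousOn.integrableOn_compact (isCompact_fit K A)

/-- Dominated convergence: the frontier of the convex set `fit K A₀` is null, and off it membership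
in `fit K A` is locally constant near `A₀`. All nearby `A` lie in the doubled copy `B`, which
supplies the bound. -/
theorem continuous_weightedIntegral (K : SolidBody n) {φ : AffinePair n → F}
    (hφ : Continuous φ) : Continuous (weightedIntegral K φ) := by
  refine continuous_iff_continuousAt.2 fun A₀ => ?_
  obtain ⟨c, hc⟩ := A₀.interior_toSet_nonempty
  set B := map (dilation c 2 two_ne_zero) A₀ with hB
  have hind : weightedIntegral K φ = fun A =>
      ∫ g, (fit K A).indicator (fun g => weight K A g • φ g) g
        ∂(Measure.addHaar : Measure (AffinePair n)) :=
    funext fun A => (integral_indicator (isClosed_fit K A).measurableSet).symm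
  rw [hind]
  refine continuousAt_of_dominated
    (bound := (fit K B).indicator fun g => detAbs g * ‖φ g‖) ?_ ?_ ?_ ?_
  · exact Eventually.of_forall fun A =>
      ((integrable_indicator_iff (isClosed_fit K A).measurableSet).2
        (integrableOn_weight_smul K A hφ)).aestronglyMeasurable
  · filter_upwards [eventually_subset_dilation A₀ hc one_lt_two] with A hA
    refine Eventually.of_forall fun g => ?_
    by_cases hg : g ∈ fit K A
    · rw [indicator_of_mem hg, indicator_of_mem (fit_mono K hA hg), norm_smul,
        Real.norm_of_nonneg (weight_nonneg K A g)]
      exact mul_le_mul_of_nonneg_right (weight_le_detAbs K A g) (norm_nonneg _)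
    · rw [indicator_of_notMem hg, norm_zero]
      exact indicator_nonneg (fun g _ => mul_nonneg (detAbs_nonneg g) (norm_nonneg _)) g
  · rw [integrable_indicator_iff (isClosed_fit K B).measurableSet]
    exact (continuous_detAbs.mul hφ.norm).continuousOn.integrableOn_compact (isCompact_fit K B)
  · have hfr := (convex_fit K A₀).addHaar_frontier (Measure.addHaar : Measure (AffinePair n))
    filter_upwards [measure_eq_zero_iff_ae_notMem.1 hfr] with g hg
    rw [(isClosed_fit K A₀).frontier_eq] at hg
    by_cases hmem : g ∈ fit K A₀
    · have hint : g ∈ interior (fit K A₀) := by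
        by_contra hcon
        exact hg ⟨hmem, hcon⟩
      refine (((continuous_weight_left K g).smul
        (continuous_const (y := φ g))).continuousAt).congr ?_
      filter_upwards [eventually_mem_fit hint] with A hA
      exact (indicator_of_mem hA fun g => weight K A g • φ g).symm
    · refine (continuousAt_const (y := (0 : F))).congr ?_
      have := (Continuous.prodMk_left g).continuousAt.eventually (eventually_notMem_fit hmem)
      filter_upwards [this] with A hA
      rw [indicator_of_notMem hA]

/-- The factor by which composition with `h` scales weighted integrals. -/
noncomputable def weightScale (h : Aff n) : ℝ := |(postcompLinear h).det| * absDet h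

/-- The Jacobian and the scaling of the weight depend only on `h`, so one factor serves every `φ`
and cancels in the average. -/
theorem weightedIntegral_map (K A : SolidBody n) (h : Aff n) (φ : AffinePair n → F) :
    weightedIntegral K φ (map h A)
      = weightScale h • weightedIntegral K (fun g => φ (postcomp h g)) A := by
  rw [weightedIntegral, fit_map, integral_image_eq_integral_abs_det_fderiv_smul _
    (isClosed_fit K A).measurableSet (fun g _ => (hasFDerivAt_postcomp h g).hasFDerivWithinAt)
    (postcomp_injective h).injOn, weightedIntegral, ← integral_smul]
  refine integral_congr_ae (Eventually.of_forall fun g => ?_)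
  simp only [weight_map_postcomp, weightScale, smul_smul, mul_assoc]

end Integral

/-! ### The weighted average off the orbit -/

/-- The total weight of the affine maps sending `K` into `A`. -/
noncomputable def totalWeight (K A : SolidBody n) : ℝ := weightedIntegral K (fun _ => (1 : ℝ)) A

theorem totalWeight_eq (K A : SolidBody n) :
    totalWeight K A = ∫ g in fit K A, weight K A g ∂(Measure.addHaar : Measure (AffinePair n)) := by
  simp [totalWeight, weightedIntegral]

theorem integrableOn_weight (K A : SolidBody n) :
    IntegrableOn (weight K A) (fit K A) (Measure.addHaar : Measure (AffinePair n)) :=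
  (continuous_weight_right K A).continuousOn.integrableOn_compact (isCompact_fit K A)

/-- When the ratio is below 1, extremal maps have positive weight. They are limits of interior
points of `fit K A`, so the weight is positive on a nonempty open subset. -/
theorem totalWeight_pos {K A : SolidBody n} (hA : fillRatio K A ≠ 1) : 0 < totalWeight K A := by
  have hlt : fillRatio K A * maxDet K A < maxDet K A :=
    mul_lt_of_lt_one_left (maxDet_pos K A) (lt_of_le_of_ne (fillRatio_le_one K A) hA)
  obtain ⟨g, hg, hdet⟩ := exists_mem_fit_detAbs_eq K A
  rw [← closure_interior_fit] at hg
  have hopen : IsOpen {g : AffinePair n | fillRatio K A * maxDet K A < detAbs g} :=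
    isOpen_lt continuous_const continuous_detAbs
  have hne := mem_closure_iff.1 hg _ hopen (hdet ▸ hlt)
  rw [totalWeight_eq, setIntegral_pos_iff_support_of_nonneg_ae
    (Eventually.of_forall (weight_nonneg K A)) (integrableOn_weight K A)]
  refine ((hopen.inter isOpen_interior).measure_pos _ hne).trans_le (measure_mono ?_)
  exact inter_subset_inter (fun g hg => ((weight_pos_iff K A g).2 hg).ne') interior_subset

/-- The weighted average of the images of `x` under the affine maps sending `K` into `A`. -/
noncomputable def weightedAverage (K : SolidBody n) (x : EucSpace n) (A : SolidBody n) :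
    EucSpace n :=
  (totalWeight K A)⁻¹ • weightedIntegral K (fun g => eval g x) A

theorem continuousAt_weightedAverage (K : SolidBody n) (x : EucSpace n) {A : SolidBody n}
    (hA : fillRatio K A ≠ 1) : ContinuousAt (weightedAverage K x) A :=
  ((continuous_weightedIntegral K continuous_const).continuousAt.inv₀
    (totalWeight_pos hA).ne').smul
      (continuous_weightedIntegral K (continuous_eval_left x)).continuousAt

theorem weightedAverage_map (K : SolidBody n) (x : EucSpace n) {A : SolidBody n} (h : Aff n)
    (hA : fillRatio K A ≠ 1) :
    weightedAverage K x (map h A) = h (weightedAverage K x A) := by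
  have hA0 : totalWeight K A ≠ 0 := (totalWeight_pos hA).ne'
  have hmap : totalWeight K (map h A) = weightScale h * totalWeight K A :=
    weightedIntegral_map K A h _
  have hhA0 : totalWeight K (map h A) ≠ 0 :=
    (totalWeight_pos (by rwa [fillRatio_map])).ne'
  -- Positivity of the total weight at `map h A` spares computing the Jacobian.
  have hscale : weightScale h ≠ 0 := left_ne_zero_of_mul (hmap ▸ hhA0)
  have hint : weightedIntegral K (fun g => eval (postcomp h g) x) A
      = (ofAff h).1 (weightedIntegral K (fun g => eval g x) A) + totalWeight K A • h 0 := by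
    rw [totalWeight_eq, ← integral_smul_const, weightedIntegral, weightedIntegral,
      ← ContinuousLinearMap.integral_comp_comm _
        (integrableOn_weight_smul K A (continuous_eval_left x)),
      ← integral_add
        ((ofAff h).1.integrable_comp (integrableOn_weight_smul K A (continuous_eval_left x)))
        ((integrableOn_weight K A).smul_const _)]
    refine integral_congr_ae (Eventually.of_forall fun g => ?_)
    simp only [eval_postcomp]
    rw [Aff_apply h (eval g x), smul_add, map_smul]
    rfl
  rw [weightedAverage, weightedAverage, weightedIntegral_map, hint, hmap, smul_smul, mul_inv_rev,
    inv_mul_cancel_right₀ hscale, smul_add, smul_smul, inv_mul_cancel₀ hA0, one_smul,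
    Aff_apply h (_ • _), ← map_smul]
  rfl

theorem weightedAverage_mem {K A : SolidBody n} {x : EucSpace n} (hA : fillRatio K A ≠ 1)
    {S : Set (EucSpace n)} (hS : Convex ℝ S) (hSo : IsOpen S)
    (h : ∀ g ∈ fit K A, fillRatio K A * maxDet K A ≤ detAbs g → eval g x ∈ S) :
    weightedAverage K x A ∈ S := by
  by_contra hnot
  set p := weightedAverage K x A with hp
  -- A separating `f` makes `f p - f (eval g x)` positive wherever the weight is; its weighted
  -- integral is zero, so the weight vanishes almost everywhere.
  obtain ⟨f, hf⟩ := geometric_hahn_banach_open_point hS hSo hnot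
  have hW := totalWeight_pos hA
  have hI := integrableOn_weight_smul K A (continuous_eval_left x)
  have hzero : ∫ g in fit K A, weight K A g * (f p - f (eval g x))
      ∂(Measure.addHaar : Measure (AffinePair n)) = 0 := by
    have h1 : weightedIntegral K (fun g => eval g x) A = totalWeight K A • p := by
      rw [hp, weightedAverage, smul_inv_smul₀ hW.ne']
    have h2 : ∫ g in fit K A, f (weight K A g • eval g x)
        ∂(Measure.addHaar : Measure (AffinePair n)) = totalWeight K A * f p := by
      rw [ContinuousLinearMap.integral_comp_comm _ hI]
      change f (weightedIntegral K (fun g => eval g x) A) = _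
      rw [h1, map_smul, smul_eq_mul]
    rw [totalWeight_eq, ← integral_mul_const] at h2
    rw [← sub_eq_zero.2 h2.symm,
      ← integral_sub ((integrableOn_weight K A).mul_const _) (f.integrable_comp hI)]
    refine integral_congr_ae (Eventually.of_forall fun g => ?_)
    simp [mul_sub]
  have hpos : ∀ g ∈ fit K A, 0 < weight K A g → 0 < f p - f (eval g x) := fun g hg hw =>
    sub_pos.2 (hf _ (h g hg ((weight_pos_iff K A g).1 hw).le))
  have hnn : ∀ g ∈ fit K A, 0 ≤ weight K A g * (f p - f (eval g x)) := fun g hg => by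
    rcases (weight_nonneg K A g).eq_or_lt with hw | hw
    · rw [← hw, zero_mul]
    · exact (mul_pos hw (hpos g hg hw)).le
  have hcont : Continuous fun g => weight K A g * (f p - f (eval g x)) :=
    (continuous_weight_right K A).mul
      (continuous_const.sub (f.continuous.comp (continuous_eval_left x)))
  have hae : ∀ᵐ g ∂(Measure.addHaar : Measure (AffinePair n)).restrict (fit K A), g ∈ fit K A :=
    ae_restrict_mem (isClosed_fit K A).measurableSet
  have hz := (setIntegral_eq_zero_iff_of_nonneg_ae (hae.mono hnn)
    (hcont.continuousOn.integrableOn_compact (isCompact_fit K A))).1 hzero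
  have : totalWeight K A = 0 := by
    rw [totalWeight_eq]
    refine integral_eq_zero_of_ae ?_
    filter_upwards [hz, hae] with g hg hgm
    by_contra hw
    have hw' := (weight_nonneg K A g).lt_of_ne' hw
    exact (mul_pos hw' (hpos g hgm hw')).ne' hg
  exact hW.ne' this

theorem eval_mem_interior {K A : SolidBody n} {x : EucSpace n} (hx : x ∈ interior K.toSet)
    {g : AffinePair n} (hg : g ∈ fit K A) (hdet : 0 < detAbs g) : eval g x ∈ interior A.toSet := by
  obtain ⟨h, rfl⟩ := exists_ofAff_eq hdet.ne'
  have himg := (AffineEquiv.toContinuousAffineEquiv h).toHomeomorph.image_interior K.toSet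
  change h '' interior K.toSet = interior (h '' K.toSet) at himg
  rw [eval_ofAff]
  exact interior_mono ((ofAff_mem_fit K A h).1 hg) (himg ▸ mem_image_of_mem h hx)

/-! ### The extension to all bodies -/

open Classical in
/-- The affine invariant point that sends `hK` to `h x`, and every body `A` that is not an affine
image of `K` to a weighted average of the images of `x` under affine maps sending `K` into `A`. -/
noncomputable def extendedPoint (K : SolidBody n) (x : EucSpace n) (A : SolidBody n) :
    EucSpace n :=
  if h : ∃ h : Aff n, map h K = A then h.choose x else weightedAverage K x A

/-- `h` followed by the inverse of `h'` is a symmetry of `K`, so it fixes `x`. Hence the choice made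
in `extendedPoint` is immaterial. -/
theorem apply_eq_of_map_eq {K : SolidBody n} {x : EucSpace n} (hx : x ∈ K.fixedPoints)
    {h h' : Aff n} (heq : map h K = map h' K) : h x = h' x := by
  have hfix := hx (h.trans h'.symm) (by rw [← map_map, heq, map_symm_map])
  rwa [AffineEquiv.trans_apply, AffineEquiv.symm_apply_eq] at hfix

theorem extendedPoint_map_self {K : SolidBody n} {x : EucSpace n} (hx : x ∈ K.fixedPoints)
    (h : Aff n) : extendedPoint K x (map h K) = h x := by
  have hex : ∃ h' : Aff n, map h' K = map h K := ⟨h, rfl⟩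
  rw [extendedPoint, dif_pos hex]
  exact apply_eq_of_map_eq hx hex.choose_spec

theorem extendedPoint_of_fillRatio_ne_one {K A : SolidBody n} (x : EucSpace n)
    (hA : fillRatio K A ≠ 1) : extendedPoint K x A = weightedAverage K x A :=
  dif_neg (mt (fillRatio_eq_one_iff K A).2 hA)

/-- On the orbit the threshold equals `maxDet K A`; the non-strict inequality lets extremal maps
count, so both cases share one criterion. -/
theorem extendedPoint_mem {K A : SolidBody n} {x : EucSpace n} (hx : x ∈ K.fixedPoints)
    {S : Set (EucSpace n)} (hS : Convex ℝ S) (hSo : IsOpen S)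
    (h : ∀ g ∈ fit K A, fillRatio K A * maxDet K A ≤ detAbs g → eval g x ∈ S) :
    extendedPoint K x A ∈ S := by
  by_cases hA : fillRatio K A = 1
  · obtain ⟨g, hg, hdet⟩ := exists_mem_fit_detAbs_eq K A
    obtain ⟨k, rfl, rfl⟩ := exists_map_eq_of_fillRatio_eq_one hA hg hdet.ge
    rw [extendedPoint_map_self hx, ← eval_ofAff]
    exact h _ hg (by rw [hA, one_mul, hdet])
  · rw [extendedPoint_of_fillRatio_ne_one x hA]
    exact weightedAverage_mem hA hS hSo h

theorem extendedPoint_map {K : SolidBody n} {x : EucSpace n} (hx : x ∈ K.fixedPoints)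
    (h : Aff n) (A : SolidBody n) : extendedPoint K x (map h A) = h (extendedPoint K x A) := by
  by_cases hA : fillRatio K A = 1
  · obtain ⟨k, rfl⟩ := (fillRatio_eq_one_iff K A).1 hA
    rw [map_map, extendedPoint_map_self hx, extendedPoint_map_self hx]
    rfl
  · rw [extendedPoint_of_fillRatio_ne_one x hA,
      extendedPoint_of_fillRatio_ne_one x (by rwa [fillRatio_map]), weightedAverage_map K x h hA]

theorem continuousAt_extendedPoint_map_self {K : SolidBody n} {x : EucSpace n}
    (hx : x ∈ K.fixedPoints) (h : Aff n) : ContinuousAt (extendedPoint K x) (map h K) := by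
  set A₀ := map h K with hA₀
  obtain ⟨c, hc⟩ := A₀.interior_toSet_nonempty
  rw [Metric.continuousAt_iff']
  intro ε hε
  have hratio : fillRatio K A₀ = 1 := fillRatio_map_self K h
  have key : ∀ᶠ A in 𝓝 A₀, ∀ g ∈ fit K (map (dilation c 2 two_ne_zero) A₀),
      g ∈ fit K A → fillRatio K A * maxDet K A ≤ detAbs g → eval g x ∈ Metric.ball (h x) ε := by
    -- By compactness it suffices to work near each `g₀`: outside `fit K A₀` membership fails
    -- nearby, below the maximum the threshold fails nearby, and an extremal `g₀` sends `x` to `h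
    -- x`.
    refine (isCompact_fit K _).eventually_forall_of_forall_eventually fun g₀ _ => ?_
    by_cases hg₀ : g₀ ∈ fit K A₀
    · rcases lt_or_ge (detAbs g₀) (maxDet K A₀) with hdet | hdet
      · have hopen : IsOpen {p : SolidBody n × AffinePair n |
            detAbs p.2 < fillRatio K p.1 * maxDet K p.1} :=
          isOpen_lt (continuous_detAbs.comp continuous_snd)
            (((continuous_fillRatio K).mul (continuous_maxDet K)).comp continuous_fst)
        have hmem : (A₀, g₀) ∈ {p : SolidBody n × AffinePair n |
            detAbs p.2 < fillRatio K p.1 * maxDet K p.1} := by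
          change detAbs g₀ < fillRatio K A₀ * maxDet K A₀
          rwa [hratio, one_mul]
        filter_upwards [hopen.mem_nhds hmem] with p hp _ hle
        exact absurd hle (not_le.2 hp)
      · obtain ⟨k, rfl, hk⟩ := exists_map_eq_of_fillRatio_eq_one hratio hg₀ hdet
        have hcont : Continuous fun p : SolidBody n × AffinePair n => eval p.2 x :=
          (continuous_eval_left x).comp continuous_snd
        have hball : Metric.ball (h x) ε ∈ 𝓝 (eval (ofAff k) x) := by
          rw [eval_ofAff, apply_eq_of_map_eq hx (hk.trans hA₀)]
          exact Metric.ball_mem_nhds _ hε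
        filter_upwards [hcont.continuousAt.eventually_mem hball] with p hp _ _
        exact hp
    · filter_upwards [eventually_notMem_fit hg₀] with p hp hmem
      exact absurd hmem hp
  filter_upwards [key, eventually_subset_dilation A₀ hc one_lt_two] with A hA hsub
  rw [hA₀, extendedPoint_map_self hx]
  exact extendedPoint_mem hx (convex_ball _ _) Metric.isOpen_ball
    fun g hg hdet => hA g (fit_mono K hsub hg) hg hdet

theorem continuous_extendedPoint {K : SolidBody n} {x : EucSpace n} (hx : x ∈ K.fixedPoints) :
    Continuous (extendedPoint K x) := by
  refine continuous_iff_continuousAt.2 fun A => ?_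
  by_cases hA : fillRatio K A = 1
  · obtain ⟨h, rfl⟩ := (fillRatio_eq_one_iff K A).1 hA
    exact continuousAt_extendedPoint_map_self hx h
  · refine (continuousAt_weightedAverage K x hA).congr ?_
    filter_upwards [(continuous_fillRatio K).continuousAt.eventually_ne hA] with B hB
    exact (extendedPoint_of_fillRatio_ne_one x hB).symm

theorem extendedPoint_mem_interior {K : SolidBody n} {x : EucSpace n} (hx : x ∈ K.fixedPoints)
    (hint : x ∈ interior K.toSet) (A : SolidBody n) :
    extendedPoint K x A ∈ interior A.toSet :=
  extendedPoint_mem hx A.convex_toSet.interior isOpen_interior fun _ hg hdet =>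
    eval_mem_interior hint hg ((fillRatio_mul_maxDet_pos K A).trans_le hdet)

theorem extendedPoint_self {K : SolidBody n} {x : EucSpace n} (hx : x ∈ K.fixedPoints) :
    extendedPoint K x K = x := by
  have hK : map (AffineEquiv.refl ℝ (EucSpace n)) K = K :=
    toSet_injective (by rw [toSet_map]; simp)
  have := extendedPoint_map_self hx (AffineEquiv.refl ℝ (EucSpace n))
  rwa [hK] at this

end SolidBody

theorem theorem3p2 (n : ℕ) (K : SolidBody n) (x : EucSpace n)
    (hx : x ∈ K.fixedPoints) (hint : x ∈ interior K.toSet) :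
    ∃ p : SolidBody n → EucSpace n, IsProperAffineInvariantPoint p ∧ p K = x :=
  ⟨SolidBody.extendedPoint K x,
    ⟨⟨SolidBody.continuous_extendedPoint hx, SolidBody.extendedPoint_map hx⟩,
      SolidBody.extendedPoint_mem_interior hx hint⟩,
    SolidBody.extendedPoint_self hx⟩
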